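/- Throughout, $\mathbb{N}_0=\{0,1,2,\dots\}$. A shift space over a finite discrete alphabet $\mathcal A$ is a closed subset $X\subseteq\mathcal A^{\mathbb Z}$ (product topology) that is invariant under the shift $\sigma(x)_i=x_{i+1}$ and its inverse; $\sigma_X$ denotes the restriction of $\sigma$ to $X$. For an infinite set $S\subseteq\mathbb{N}_0$, the $S$-gap shift $\mathsf X(S)\subseteq\{0,1\}^{\mathbb Z}$ is the shift space of all bi-infinite binary sequences in which none of the words $10^k1$ with $k\in\mathbb{N}_0\setminus S$ occurs; that is, the number of $0$'s between any two consecutive $1$'s belongs to $S$. For a shift space $X$, the suspension $SX$ is the quotient space of $X\times\mathbb R$ by the equivalence relation generated by $(x,t+1)\sim(\sigma_X(x),t)$, and $[x,t]$ denotes the class of $(x,t)$. Two shift spaces $X$ and $Y$ are flow equivalent, $X\sim_{FE}Y$, if there is a homeomorphism $\Phi\colon SX\to SY$ such that for each $[x,t]\in SX$ there is a monotonically increasing function $\phi_{[x,t]}\colon\mathbb R\to\mathbb R$ for which $\Phi([x,t])=[y,t']$ implies $\Phi([x,t+r])=[y,t'+\phi_{[x,t]}(r)]$ for all $r\in\mathbb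 R$. **Theorem.** Let $S$ and $R$ be infinite subsets of $\mathbb{N}_0$ such that $\mathsf X(S)\sim_{FE}\mathsf X(R)$. Then there exist subsets $S'\subseteq S$ and $R'\subseteq R$ with $S\setminus S'$ and $R\setminus R'$ finite, and an integer $r\in\mathbb Z$, such that $S'+r=R'$, where $S'+r=\{s+r\mid s\in S'\}$. -/

import Mathlib

open SymbolicDynamics.FullShift

namespace GapShift

/-- The finite word `w = w₀ w₁ … w_{n-1}` as a pattern on `ℤ` with support `{0, …, n-1}`. -/
noncomputable def wordPattern {A : Type*} [Inhabited A] (w : List A) : Pattern A ℤ where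
  config i := if 0 ≤ i then w.getD i.toNat default else default
  support := Finset.Ico 0 (w.length : ℤ)
  condition i hi := by
    split_ifs with h
    · have hlen : w.length ≤ i.toNat := by
        simp only [Finset.mem_Ico, not_and, not_lt] at hi
        have := hi h
        omega
      exact List.getD_eq_default _ _ hlen
    · rfl

/-- Forbidden words of the `S`-gap shift: all words `1 0ᵏ 1` with `k ∉ S`, and all words `0ᵐ` with
`m` larger than every element of `S`. There are words of the second kind only if `S` is finite;
so for infinite `S` only the words `1 0ᵏ 1` with `k ∉ S` are forbidden. -/
def gapForbidden (S : Set ℕ) : Set (List (Fin 2)) :=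
  {w | ∃ k, k ∉ S ∧ w = 1 :: (List.replicate k 0 ++ [1])} ∪
    {w | ∃ m, (∀ s ∈ S, s < m) ∧ w = List.replicate m 0}

/-- The `S`-gap shift `X(S)`: the bi-infinite binary sequences such that the number of `0`s between
any two consecutive `1`s belongs to `S`. -/
noncomputable def gapShift (S : Set ℕ) : Subshift (Fin 2) ℤ :=
  Subshift.ofForbidden (wordPattern '' gapForbidden S)

section Flow

variable {A B : Type*} [TopologicalSpace A] [TopologicalSpace B]

/-- The shift map `σ_X : X → X`, `(σ_X x)ᵢ = x_{i+1}`. -/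
def shiftMap (X : Subshift A ℤ) (x : X.carrier) : X.carrier :=
  ⟨shift 1 x.1, X.mapsTo 1 x.2⟩

/-- The identifications `(x, t + 1) ∼ (σ_X x, t)` on `X × ℝ`. -/
def suspensionRel (X : Subshift A ℤ) (p q : X.carrier × ℝ) : Prop :=
  ∃ (x : X.carrier) (t : ℝ), p = (x, t + 1) ∧ q = (shiftMap X x, t)

/-- The suspension `SX`: the quotient of `X × ℝ` (product topology) by the equivalence relation
generated by `(x, t + 1) ∼ (σ_X x, t)`, with the quotient topology. -/
abbrev Suspension (X : Subshift A ℤ) : Type _ := Quot (suspensionRel X)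

/-- The class `[x, t]` in `SX`. -/
def Suspension.mk (X : Subshift A ℤ) (x : X.carrier) (t : ℝ) : Suspension X :=
  Quot.mk _ (x, t)

/-- A homeomorphism `Φ : SX ≃ SY` is a flow equivalence if for every `[x, t]` there is an increasing
function `φ : ℝ → ℝ` such that `Φ [x, t] = [y, t']` implies `Φ [x, t + r] = [y, t' + φ r]` for all
real `r`. (As `Φ` is injective, such a `φ` is automatically strictly increasing.) -/
def IsFlowEquivalence (X : Subshift A ℤ) (Y : Subshift B ℤ) (Φ : Suspension X ≃ₜ Suspension Y) :
    Prop :=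
  ∀ (x : X.carrier) (t : ℝ), ∃ φ : ℝ → ℝ, Monotone φ ∧
    ∀ (y : Y.carrier) (t' : ℝ), Φ (Suspension.mk X x t) = Suspension.mk Y y t' →
      ∀ r : ℝ, Φ (Suspension.mk X x (t + r)) = Suspension.mk Y y (t' + φ r)

/-- `X` and `Y` are flow equivalent. -/
def FlowEquivalent (X : Subshift A ℤ) (Y : Subshift B ℤ) : Prop :=
  ∃ Φ : Suspension X ≃ₜ Suspension Y, IsFlowEquivalence X Y Φ

end Flow

end GapShift

/-! Shift spaces are totally disconnected, so a flow equivalence lifts to `(x, r) ↦ (F x, L (x,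
r))`, where `F` is continuous, sends orbits to orbits and has an integer-valued continuous cocycle
`N`; the inverse gives `G` and `M`. Symbols of `F x` are thus determined locally by `x`, up to the
reparametrization `N`.

Suppose `F` and `G` preserve the fixed point `0^∞`. Monotonicity of the flow forces one step along
`0^∞` to become exactly one step. The point with a single `1` then has an image with finitely many,
but some, nonzero symbols. Two `1`s with a long gap `s ∈ S` give two copies of this image, separated
by a gap `s + c` with `c` independent of `s` (`exists_gap`). So eventually `S + c ⊆ R`, likewise `R
+ c' ⊆ S`, and finiteness of the residue classes modulo `c + c'` turns this into eventual equality.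

If `F` moves `0^∞`, its image is a periodic point containing a `1`, which `G` sends to `0^∞`.
Detours from this periodic orbit can be repeated after any number of periods; applying `exists_gap`
to `G` shows that `S` contains all large integers. The same holds for `R` if `G` moves `0^∞`. Two
cofinite sets satisfy the theorem with `r = 0`; if one set is not cofinite, both fixed points are
preserved. -/

namespace GapShift

open Topology Set

/-! ### Suspensions and lifts of maps between them -/

section Suspension

variable {A B : Type*} [TopologicalSpace A] [TopologicalSpace B]

/-- The `k`-th power of the shift map of `X`. -/
def shiftBy (X : Subshift A ℤ) (k : ℤ) (x : X.carrier) : X.carrier :=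
  ⟨shift k x.1, X.mapsTo k x.2⟩

variable (X : Subshift A ℤ) (Y : Subshift B ℤ)

@[simp] lemma shiftBy_apply (k : ℤ) (x : X.carrier) (i : ℤ) :
    (shiftBy X k x).1 i = x.1 (k + i) := rfl

@[simp] lemma shiftBy_zero (x : X.carrier) : shiftBy X 0 x = x := by
  apply Subtype.ext; funext i; simp

@[simp] lemma shiftBy_shiftBy (k l : ℤ) (x : X.carrier) :
    shiftBy X k (shiftBy X l x) = shiftBy X (k + l) x := by
  apply Subtype.ext; funext i; exact congrArg x.1 (by ring)

lemma shiftBy_mul_of_periodic {X : Subshift A ℤ} {P : ℤ} {p : X.carrier} (hp : shiftBy X P p = p)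
    (k : ℤ) :
    shiftBy X (k * P) p = p := by
  induction k using Int.induction_on with
  | zero => simp
  | succ n ih => rw [add_mul, one_mul, ← shiftBy_shiftBy, hp, ih]
  | pred n ih =>
    conv_lhs => rw [← hp, shiftBy_shiftBy, show (-(n : ℤ) - 1) * P + P = -n * P by ring, ih]

lemma continuous_shiftBy (k : ℤ) : Continuous (shiftBy X k) :=
  Continuous.subtype_mk ((continuous_shift k).comp continuous_subtype_val) _

lemma mk_add_one (x : X.carrier) (t : ℝ) :
    Suspension.mk X x (t + 1) = Suspension.mk X (shiftBy X 1 x) t :=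
  Quot.sound ⟨x, t, rfl, rfl⟩

lemma mk_add_intCast (k : ℤ) : ∀ (x : X.carrier) (t : ℝ),
    Suspension.mk X x (t + k) = Suspension.mk X (shiftBy X k x) t := by
  induction k using Int.induction_on with
  | zero => intro x t; simp
  | succ n ih =>
    intro x t
    have h := mk_add_one X x (t + (n : ℤ))
    rw [ih] at h
    rw [shiftBy_shiftBy] at h
    rw [← h]; push_cast; congr 1; ring
  | pred n ih =>
    intro x t
    have h := mk_add_one X (shiftBy X (-1) x) (t + ((-n - 1 : ℤ) : ℝ))
    rw [shiftBy_shiftBy] at h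
    simp only [Int.reduceNeg, add_neg_cancel, shiftBy_zero] at h
    rw [← h]
    have h2 := ih (shiftBy X (-1) x) t
    rw [shiftBy_shiftBy] at h2
    rw [show (-(n : ℤ) - 1) = -n + -1 by ring, ← h2]
    congr 1; push_cast; ring

lemma mk_eq_mk_iff {x x' : X.carrier} {t t' : ℝ} :
    Suspension.mk X x t = Suspension.mk X x' t' ↔ ∃ k : ℤ, t = t' + k ∧ x' = shiftBy X k x := by
  constructor
  · intro h
    have h := Quot.eqvGen_exact h
    have key : ∀ p q : X.carrier × ℝ, Relation.EqvGen (suspensionRel X) p q →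
        ∃ k : ℤ, p.2 = q.2 + k ∧ q.1 = shiftBy X k p.1 := by
      intro p q hpq
      induction hpq with
      | rel p q hr =>
        obtain ⟨x, t, rfl, rfl⟩ := hr
        exact ⟨1, by simp, rfl⟩
      | refl p => exact ⟨0, by simp⟩
      | symm p q _ ih =>
        obtain ⟨k, h1, h2⟩ := ih
        exact ⟨-k, by rw [h1]; push_cast; ring, by rw [h2]; simp⟩
      | trans p q r _ _ ih1 ih2 =>
        obtain ⟨k, h1, h2⟩ := ih1
        obtain ⟨l, h3, h4⟩ := ih2
        exact ⟨l + k, by rw [h1, h3]; push_cast; ring, by rw [h4, h2]; simp⟩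
    exact key _ _ h
  · rintro ⟨k, rfl, rfl⟩
    exact mk_add_intCast X k x t'

/-- The class modulo `1` of the time coordinate of a point of the suspension. -/
def phase : Suspension X → UnitAddCircle :=
  Quot.lift (fun p => (p.2 : UnitAddCircle)) (by
    rintro _ _ ⟨x, t, rfl, rfl⟩
    simp)

@[simp] lemma phase_mk (x : X.carrier) (t : ℝ) :
    phase X (Suspension.mk X x t) = (t : UnitAddCircle) := rfl

lemma continuous_phase : Continuous (phase X) :=
  continuous_quot_lift _ ((AddCircle.continuous_mk' (1 : ℝ)).comp continuous_snd)

lemma continuous_mk : Continuous fun p : X.carrier × ℝ => Suspension.mk X p.1 p.2 :=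
  continuous_quot_mk

lemma isOpenMap_mk : IsOpenMap fun p : X.carrier × ℝ => Suspension.mk X p.1 p.2 := by
  intro W hW
  rw [← isQuotientMap_quot_mk.isOpen_preimage]
  -- The saturation of `W` is the union of its translates under the `ℤ`-action on `X × ℝ`.
  have : (Quot.mk (suspensionRel X)) ⁻¹' ((fun p : X.carrier × ℝ => Suspension.mk X p.1 p.2) '' W)
      = ⋃ k : ℤ, (fun p : X.carrier × ℝ => (shiftBy X k p.1, p.2 - k)) ⁻¹' W := by
    ext p
    simp only [mem_preimage, mem_image, mem_iUnion]
    constructor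
    · rintro ⟨q, hq, h⟩
      have h : Suspension.mk X p.1 p.2 = Suspension.mk X q.1 q.2 := h.symm
      obtain ⟨k, h1, h2⟩ := (mk_eq_mk_iff X).1 h
      refine ⟨k, ?_⟩
      rw [h1, ← h2]; simpa using hq
    · rintro ⟨k, hk⟩
      exact ⟨_, hk, ((mk_eq_mk_iff X).2 ⟨k, by simp, rfl⟩ : Suspension.mk X p.1 p.2 = _).symm⟩
  rw [this]
  refine isOpen_iUnion fun k => hW.preimage ?_
  exact ((continuous_shiftBy X k).comp continuous_fst).prodMk (continuous_snd.sub continuous_const)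

lemma coe_eq_coe_iff_exists_int {s t : ℝ} :
    (s : UnitAddCircle) = t ↔ ∃ k : ℤ, s = t + k := by
  rw [← sub_eq_zero, ← AddCircle.coe_sub, AddCircle.coe_eq_zero_iff]
  constructor
  · rintro ⟨k, hk⟩; exact ⟨k, by simp at hk; linarith⟩
  · rintro ⟨k, hk⟩; exact ⟨k, by simp; linarith⟩

lemma exists_mk_eq_of_phase {p : Suspension X} {l : ℝ} (h : phase X p = l) :
    ∃ x, p = Suspension.mk X x l := by
  induction p using Quot.ind with
  | mk a =>
    obtain ⟨k, hk⟩ := coe_eq_coe_iff_exists_int.1 (show (a.2 : UnitAddCircle) = l from h)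
    exact ⟨shiftBy X k a.1, (mk_eq_mk_iff X).2 ⟨k, hk, rfl⟩⟩

/-- Two representatives of a class differ by a power of the shift and the same integer in time;
times that stay within `1/4` of `l z` force that integer to be `0`. -/
lemma continuous_of_mk_eq {Z : Type*} [TopologicalSpace Z] {f : Z → Suspension X} {l : Z → ℝ}
    {y : Z → X.carrier} (hf : Continuous f) (hl : Continuous l)
    (h : ∀ z, f z = Suspension.mk X (y z) (l z)) : Continuous y := by
  rw [continuous_iff_continuousAt]
  intro z
  rw [ContinuousAt, Filter.tendsto_def]
  intro U hU
  obtain ⟨V, hVU, hV, hzV⟩ := mem_nhds_iff.1 hU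
  have hW : IsOpen ((fun p : X.carrier × ℝ => Suspension.mk X p.1 p.2) ''
      (V ×ˢ Metric.ball (l z) (1 / 4))) := isOpenMap_mk X _ (hV.prod Metric.isOpen_ball)
  have h1 := (hW.preimage hf).mem_nhds (x := z) ⟨(y z, l z), ⟨hzV, by simp⟩, (h z).symm⟩
  have h2 := (Metric.isOpen_ball.preimage hl).mem_nhds (x := z)
    (show l z ∈ Metric.ball (l z) (1 / 4) by simp)
  filter_upwards [h1, h2] with w hw1 hw2
  obtain ⟨⟨u, s⟩, ⟨hu, hs⟩, hus⟩ := hw1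
  apply hVU
  have hus : Suspension.mk X u s = Suspension.mk X (y w) (l w) := by rw [← h w]; exact hus
  obtain ⟨k, hk1, hk2⟩ := (mk_eq_mk_iff X).1 hus
  simp only [mem_preimage, Metric.mem_ball, Real.dist_eq, abs_lt] at hw2 hs
  have hk : k = 0 := by
    have a1 : (k : ℝ) < 1 := by linarith [hs.2, hw2.1]
    have a2 : (-1 : ℝ) < k := by linarith [hs.1, hw2.2]
    have : k < 1 := by exact_mod_cast a1
    have : -1 < k := by exact_mod_cast a2
    omega
  subst hk
  show y w ∈ V
  rw [hk2]; simpa using hu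

/-- A clopen set separates the fibres over `1/2` and `0`; on each side the circle can be cut at the
point that is not attained there. -/
lemma exists_continuous_lift_unitAddCircle {Z : Type*} [TopologicalSpace Z] [CompactSpace Z]
    [T2Space Z] [TotallyDisconnectedSpace Z] {f : Z → UnitAddCircle} (hf : Continuous f) :
    ∃ l : Z → ℝ, Continuous l ∧ ∀ z, (l z : UnitAddCircle) = f z := by
  have h2 : IsClosed (f ⁻¹' {((1 / 2 : ℝ) : UnitAddCircle)}) := isClosed_singleton.preimage hf
  have h0 : IsOpen (f ⁻¹' {((0 : ℝ) : UnitAddCircle)}ᶜ) := isOpen_compl_singleton.preimage hf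
  have hne : ((1 / 2 : ℝ) : UnitAddCircle) ≠ ((0 : ℝ) : UnitAddCircle) := by
    rw [Ne, coe_eq_coe_iff_exists_int]
    rintro ⟨k, hk⟩
    have h3 : (1 : ℝ) = ((2 * k : ℤ) : ℝ) := by push_cast; linarith
    have h4 : (1 : ℤ) = 2 * k := by exact_mod_cast h3
    omega
  obtain ⟨C, hC, hC2, hC0⟩ := exists_clopen_of_closed_subset_open h2 h0 (by
    intro z hz
    simp only [mem_preimage, mem_singleton_iff, mem_compl_iff] at hz ⊢
    rw [hz]; exact hne)
  have : Fact ((0 : ℝ) < 1) := ⟨one_pos⟩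
  classical
  refine ⟨fun z => if z ∈ C then (AddCircle.equivIco 1 0 (f z) : ℝ)
    else (AddCircle.equivIco 1 (1 / 2) (f z) : ℝ), ?_, ?_⟩
  · rw [continuous_iff_continuousAt]
    intro z
    by_cases hz : z ∈ C
    · have hc : ContinuousAt (fun z => (AddCircle.equivIco 1 0 (f z) : ℝ)) z :=
        continuous_subtype_val.continuousAt.comp
          ((AddCircle.continuousAt_equivIco 1 (0 : ℝ) (hC0 hz)).comp hf.continuousAt)
      refine hc.congr ?_
      filter_upwards [hC.isOpen.mem_nhds hz] with w hw
      simp [hw]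
    · have hc : ContinuousAt (fun z => (AddCircle.equivIco 1 (1 / 2) (f z) : ℝ)) z :=
        continuous_subtype_val.continuousAt.comp
          ((AddCircle.continuousAt_equivIco 1 (1 / 2 : ℝ) (fun h => hz (hC2 h))).comp
            hf.continuousAt)
      refine hc.congr ?_
      filter_upwards [hC.compl.isOpen.mem_nhds hz] with w hw
      have hw : w ∉ C := hw
      simp [hw]
  · intro z
    by_cases hz : z ∈ C <;> simp only [hz, if_true, if_false] <;> exact AddCircle.coe_equivIco

/-- Lift on the slice `r = 0`, then apply homotopy lifting to the contraction `(z, r) ↦ (z, t r)`.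
-/
lemma exists_continuous_lift_prod_real {Z : Type*} [TopologicalSpace Z] [CompactSpace Z]
    [T2Space Z] [TotallyDisconnectedSpace Z] {f : Z × ℝ → UnitAddCircle} (hf : Continuous f) :
    ∃ l : Z × ℝ → ℝ, Continuous l ∧ ∀ z, (l z : UnitAddCircle) = f z := by
  obtain ⟨l₀, hl₀, h⟩ := exists_continuous_lift_unitAddCircle
    (hf.comp (continuous_id.prodMk continuous_const : Continuous fun z : Z => (z, (0 : ℝ))))
  have : Fact ((0 : ℝ) < 1) := ⟨one_pos⟩
  let H : C(unitInterval × (Z × ℝ), UnitAddCircle) :=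
    ⟨fun q => f (q.2.1, (q.1 : ℝ) * q.2.2), hf.comp (by fun_prop)⟩
  let g : C(Z × ℝ, ℝ) := ⟨fun q => l₀ q.1, by fun_prop⟩
  have H0 : ∀ a, H (0, a) = ((g a : ℝ) : UnitAddCircle) := by
    intro a
    simp only [H, g, ContinuousMap.coe_mk]
    rw [h]; simp
  have cov := AddCircle.isCoveringMap_coe (1 : ℝ)
  refine ⟨fun q => cov.liftHomotopy H g H0 (1, q), by fun_prop, fun q => ?_⟩
  have := congrFun (cov.liftHomotopy_lifts H g H0) (1, q)
  simp only [Function.comp_apply] at this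
  rw [this]
  simp [H]

instance [Finite A] : CompactSpace X.carrier := isCompact_iff_compactSpace.1 X.isClosed.isCompact

/-- A continuous map between suspensions lifts to a continuous map `(x, r) ↦ (F x, L (x, r))`. -/
lemma exists_lift_suspension [Finite A] [DiscreteTopology A] [DiscreteTopology B]
    {Φ : Suspension X → Suspension Y} (hΦ : Continuous Φ) :
    ∃ (F : X.carrier → Y.carrier) (L : X.carrier × ℝ → ℝ), Continuous F ∧ Continuous L ∧
      ∀ x r, Φ (Suspension.mk X x r) = Suspension.mk Y (F x) (L (x, r)) := by
  have hc : Continuous fun q : X.carrier × ℝ => Φ (Suspension.mk X q.1 q.2) :=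
    hΦ.comp (continuous_mk X)
  obtain ⟨L, hL, hLΦ⟩ := exists_continuous_lift_prod_real ((continuous_phase Y).comp hc)
  choose y hy using fun q => exists_mk_eq_of_phase Y (hLΦ q).symm
  have hyc : Continuous y := continuous_of_mk_eq Y hc hL hy
  -- The connected line `{x} × ℝ` has constant image in the totally disconnected space `Y`.
  have hconst : ∀ x r, y (x, r) = y (x, 0) := by
    intro x r
    have hp : IsPreconnected (range fun r : ℝ => y (x, r)) :=
      isPreconnected_range (hyc.comp (by fun_prop))
    exact hp.subsingleton ⟨r, rfl⟩ ⟨0, rfl⟩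
  refine ⟨fun x => y (x, 0), L, hyc.comp (by fun_prop), hL, fun x r => ?_⟩
  exact (hy (x, r)).trans (by rw [hconst x r])

end Suspension

/-! ### Orbit maps, their cocycles and locality -/

section Cocycle

variable {A B : Type*} [TopologicalSpace A] [TopologicalSpace B]

/-- A continuous map `F` between shift spaces that sends orbits to orbits, with continuous
cocycle `N`. -/
structure IsOrbitMap (X : Subshift A ℤ) (Y : Subshift B ℤ) (F : X.carrier → Y.carrier)
    (N : X.carrier → ℤ → ℤ) : Prop where
  continuous : Continuous F
  continuous_cocycle : ∀ k, Continuous fun x => N x k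
  map_shiftBy : ∀ k x, F (shiftBy X k x) = shiftBy Y (N x k) (F x)
  cocycle_add : ∀ x k l, N x (k + l) = N x k + N (shiftBy X k x) l

lemma continuous_of_continuous_intCast {Z : Type*} [TopologicalSpace Z] {f : Z → ℤ}
    (hf : Continuous fun z => (f z : ℝ)) : Continuous f :=
  Int.isClosedEmbedding_coe_real.isInducing.continuous_iff.2 hf

variable {X : Subshift A ℤ} {Y : Subshift B ℤ} {F : X.carrier → Y.carrier}
  {N : X.carrier → ℤ → ℤ}

/-- `[x, r + k] = [σ^k x, r]` has two lifted images, which differ by an integer. This integer is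
continuous in `(x, r)`, hence independent of `r`. -/
lemma exists_isOrbitMap {Φ : Suspension X → Suspension Y} {L : X.carrier × ℝ → ℝ}
    (hF : Continuous F) (hL : Continuous L)
    (h : ∀ x r, Φ (Suspension.mk X x r) = Suspension.mk Y (F x) (L (x, r))) :
    ∃ N : X.carrier → ℤ → ℤ, IsOrbitMap X Y F N ∧
      ∀ x (k : ℤ) (r : ℝ), L (x, r + k) = L (shiftBy X k x, r) + N x k := by
  have key : ∀ (k : ℤ) (q : X.carrier × ℝ), ∃ j : ℤ,
      L (q.1, q.2 + k) = L (shiftBy X k q.1, q.2) + j ∧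
      F (shiftBy X k q.1) = shiftBy Y j (F q.1) := by
    intro k q
    apply (mk_eq_mk_iff Y).1
    rw [← h, ← h, mk_add_intCast]
  choose j hj1 hj2 using key
  have hjc : ∀ k, Continuous (j k) := by
    intro k
    apply continuous_of_continuous_intCast
    have : (fun q => (j k q : ℝ)) = fun q => L (q.1, q.2 + k) - L (shiftBy X k q.1, q.2) := by
      funext q; rw [hj1]; ring
    rw [this]
    have := continuous_shiftBy X k
    fun_prop
  have hconst : ∀ k x r, j k (x, r) = j k (x, 0) := by
    intro k x r
    have hp : IsPreconnected (range fun r : ℝ => j k (x, r)) :=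
      isPreconnected_range ((hjc k).comp (by fun_prop))
    exact hp.subsingleton ⟨r, rfl⟩ ⟨0, rfl⟩
  have hLN : ∀ x (k : ℤ) (r : ℝ), L (x, r + k) = L (shiftBy X k x, r) + j k (x, 0) := by
    intro x k r
    rw [← hconst k x r]; exact hj1 k (x, r)
  refine ⟨fun x k => j k (x, 0), ⟨hF, fun k => (hjc k).comp (by fun_prop),
    fun k x => hj2 k (x, 0), fun x k l => ?_⟩, hLN⟩
  have h1 := hLN x (k + l) 0
  have h2 := hLN x k l
  have h3 := hLN (shiftBy X k x) l 0
  rw [shiftBy_shiftBy, add_comm l k] at h3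
  have h4 : (0 : ℝ) + ((k + l : ℤ) : ℝ) = l + k := by push_cast; ring
  rw [h4] at h1
  rw [zero_add] at h3
  have : ((j (k + l) (x, 0) : ℤ) : ℝ) = ((j k (x, 0) + j l (shiftBy X k x, 0) : ℤ) : ℝ) := by
    push_cast; linarith
  exact_mod_cast this

/-- Otherwise the pairs that agree on `[-W, W]` but have different values form a decreasing sequence
of nonempty compact sets, and a common point would be a diagonal pair. -/
lemma exists_window [Finite A] [DiscreteTopology A] {D : Type*} [TopologicalSpace D]
    [DiscreteTopology D] {f : X.carrier → D} (hf : Continuous f) :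
    ∃ W : ℕ, ∀ x x' : X.carrier, (∀ i, -(W : ℤ) ≤ i → i ≤ W → x.1 i = x'.1 i) → f x = f x' := by
  by_contra! hcon
  let E : ℕ → Set (X.carrier × X.carrier) := fun W =>
    {q | (∀ i, -(W : ℤ) ≤ i → i ≤ W → q.1.1 i = q.2.1 i) ∧ f q.1 ≠ f q.2}
  have hclosed : ∀ W, IsClosed (E W) := by
    intro W
    apply IsClosed.inter
    · have : {q : X.carrier × X.carrier | ∀ i, -(W : ℤ) ≤ i → i ≤ W → q.1.1 i = q.2.1 i} =
          ⋂ (i : ℤ) (_ : -(W : ℤ) ≤ i) (_ : i ≤ W), {q | q.1.1 i = q.2.1 i} := by ext; simp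
      change IsClosed {q : X.carrier × X.carrier | ∀ i, -(W : ℤ) ≤ i → i ≤ W → q.1.1 i = q.2.1 i}
      rw [this]
      refine isClosed_iInter fun i => isClosed_iInter fun _ => isClosed_iInter fun _ => ?_
      exact isClosed_eq ((continuous_apply i).comp (continuous_subtype_val.comp continuous_fst))
        ((continuous_apply i).comp (continuous_subtype_val.comp continuous_snd))
    · have hc : Continuous fun q : X.carrier × X.carrier => (f q.1, f q.2) := by fun_prop
      exact (isClosed_discrete {d : D × D | d.1 ≠ d.2}).preimage hc
  have hne : ∀ W, (E W).Nonempty := by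
    intro W
    obtain ⟨x, x', h1, h2⟩ := hcon W
    exact ⟨(x, x'), h1, h2⟩
  obtain ⟨⟨x, x'⟩, hx⟩ := IsCompact.nonempty_iInter_of_sequence_nonempty_isCompact_isClosed E
    (fun W q hq => ⟨fun i h1 h2 => hq.1 i (by push_cast; omega) (by push_cast; omega), hq.2⟩)
    hne (hclosed 0).isCompact hclosed
  rw [mem_iInter] at hx
  apply (hx 0).2
  congr 1
  apply Subtype.ext
  funext i
  exact (hx i.natAbs).1 i (by omega) (by omega)

namespace IsOrbitMap

lemma cocycle_zero (hF : IsOrbitMap X Y F N) (x : X.carrier) : N x 0 = 0 := by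
  have := hF.cocycle_add x 0 0
  simp only [add_zero, shiftBy_zero] at this
  omega

lemma apply_cocycle_add (hF : IsOrbitMap X Y F N) (x : X.carrier) (k v : ℤ) :
    (F x).1 (N x k + v) = (F (shiftBy X k x)).1 v := by
  rw [hF.map_shiftBy]; rfl

variable [Finite A] [DiscreteTopology A] [DiscreteTopology B]

lemma exists_bound_window (hF : IsOrbitMap X Y F N) :
    ∃ V W : ℕ, (∀ x, |N x 1| ≤ V) ∧ ∀ x x' : X.carrier,
      (∀ i, -(W : ℤ) ≤ i → i ≤ W → x.1 i = x'.1 i) →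
        N x 1 = N x' 1 ∧ ∀ v : ℤ, |v| ≤ V → (F x).1 v = (F x').1 v := by
  have hb : ∃ V : ℕ, ∀ x, |N x 1| ≤ V := by
    have hfin : (range fun x => |N x 1|).Finite :=
      (isCompact_range ((continuous_of_discreteTopology (f := fun n : ℤ => |n|)).comp
        (hF.continuous_cocycle 1))).finite_of_discrete
    obtain ⟨M, hM⟩ := hfin.bddAbove
    refine ⟨M.toNat, fun x => ?_⟩
    have := hM ⟨x, rfl⟩
    simp only at this
    omega
  obtain ⟨V, hV⟩ := hb
  have hc : Continuous fun x => (N x 1, fun v : Finset.Icc (-(V : ℤ)) V => (F x).1 v) := by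
    refine (hF.continuous_cocycle 1).prodMk (continuous_pi fun v => ?_)
    exact (continuous_apply _).comp (continuous_subtype_val.comp hF.continuous)
  obtain ⟨W, hW⟩ := exists_window hc
  refine ⟨V, W, hV, fun x x' hx => ?_⟩
  have := Prod.ext_iff.1 (hW x x' hx)
  refine ⟨this.1, fun v hv => ?_⟩
  rw [abs_le] at hv
  exact congrFun this.2 ⟨v, by simpa using hv⟩

lemma exists_window_period (hF : IsOrbitMap X Y F N) (P : ℤ) :
    ∃ W : ℕ, ∀ x x' : X.carrier, (∀ i, -(W : ℤ) ≤ i → i ≤ W → x.1 i = x'.1 i) →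
      N x P = N x' P ∧ (F x).1 0 = (F x').1 0 := by
  have hc : Continuous fun x => (N x P, (F x).1 0) :=
    (hF.continuous_cocycle P).prodMk
      ((continuous_apply _).comp (continuous_subtype_val.comp hF.continuous))
  obtain ⟨W, hW⟩ := exists_window hc
  exact ⟨W, fun x x' hx => Prod.ext_iff.1 (hW x x' hx)⟩

end IsOrbitMap

end Cocycle

/-! ### Transfer of long gaps through an orbit map -/

section Transfer

variable {A B : Type*} [TopologicalSpace A] [TopologicalSpace B]
  {X : Subshift A ℤ} {Y : Subshift B ℤ} {F : X.carrier → Y.carrier} {N : X.carrier → ℤ → ℤ}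

namespace IsOrbitMap

/-- The increments of `N x` and `N h` coincide up to `C`, and both cocycles vanish at `0 ≤ C`. Since
steps of `N` are at most `V`, every position `j ≤ N h C` lies within `V` of some `N h i` with `i ≤
C`, where the window determines the symbol. -/
lemma eq_of_agree_left (hF : IsOrbitMap X Y F N) {V W : ℕ} (hV : ∀ x, |N x 1| ≤ V)
    (hW : ∀ x x' : X.carrier, (∀ i, -(W : ℤ) ≤ i → i ≤ W → x.1 i = x'.1 i) →
        N x 1 = N x' 1 ∧ ∀ v : ℤ, |v| ≤ V → (F x).1 v = (F x').1 v)
    {x h : X.carrier} {C : ℤ} (hC : 0 ≤ C) (hx : ∀ i ≤ C + W, x.1 i = h.1 i)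
    (hN : ∀ j, ∃ i ≤ C, N h i ≤ j) :
    N x C = N h C ∧ ∀ j ≤ N h C, (F x).1 j = (F h).1 j := by
  have hloc : ∀ i ≤ C, N (shiftBy X i x) 1 = N (shiftBy X i h) 1 ∧
      ∀ v : ℤ, |v| ≤ V → (F (shiftBy X i x)).1 v = (F (shiftBy X i h)).1 v :=
    fun i hi => hW _ _ fun l _ h2 => hx _ (by omega)
  have hd : ∀ i ≤ C, N x i - N h i = N x C - N h C := by
    intro i hi
    induction i, hi using Int.leInductionDown with
    | base => rfl
    | pred n hn ih =>
      have h1 := hF.cocycle_add x (n - 1) 1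
      have h2 := hF.cocycle_add h (n - 1) 1
      rw [sub_add_cancel] at h1 h2
      have := (hloc (n - 1) (by omega)).1
      omega
  have hC' : N x C = N h C := by
    have := hd 0 hC
    rw [hF.cocycle_zero, hF.cocycle_zero] at this
    omega
  refine ⟨hC', fun j hj => ?_⟩
  obtain ⟨i, ⟨hi, hij⟩, hmax⟩ := Int.exists_greatest_of_bdd
    (P := fun i => i ≤ C ∧ N h i ≤ j) ⟨C, fun i hi => hi.1⟩ (hN j)
  have hstep : j - N h i ≤ V := by
    rcases hi.eq_or_lt with rfl | hlt
    · omega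
    · by_contra hcon
      have h1 := hF.cocycle_add h i 1
      have h2 := abs_le.1 (hV (shiftBy X i h))
      have := hmax (i + 1) ⟨by omega, by omega⟩
      omega
  have hNi : N x i = N h i := by have := hd i hi; omega
  have := (hloc i hi).2 (j - N h i) (abs_le.2 ⟨by omega, hstep⟩)
  rw [← hF.apply_cocycle_add, ← hF.apply_cocycle_add, hNi] at this
  simpa using this

lemma eq_of_agree_right (hF : IsOrbitMap X Y F N) {V W : ℕ} (hV : ∀ x, |N x 1| ≤ V)
    (hW : ∀ x x' : X.carrier, (∀ i, -(W : ℤ) ≤ i → i ≤ W → x.1 i = x'.1 i) →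
        N x 1 = N x' 1 ∧ ∀ v : ℤ, |v| ≤ V → (F x).1 v = (F x').1 v)
    {x h : X.carrier} {C : ℤ} (hC : C ≤ 0) (hx : ∀ i, C - W ≤ i → x.1 i = h.1 i)
    (hN : ∀ j, ∃ i, C ≤ i ∧ j ≤ N h i) :
    N x C = N h C ∧ ∀ j, N h C ≤ j → (F x).1 j = (F h).1 j := by
  have hloc : ∀ i, C ≤ i → N (shiftBy X i x) 1 = N (shiftBy X i h) 1 ∧
      ∀ v : ℤ, |v| ≤ V → (F (shiftBy X i x)).1 v = (F (shiftBy X i h)).1 v :=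
    fun i hi => hW _ _ fun l _ h2 => hx _ (by omega)
  have hd : ∀ i, C ≤ i → N x i - N h i = N x C - N h C := by
    intro i hi
    induction i, hi using Int.leInduction with
    | base => rfl
    | succ n hn ih =>
      have h1 := hF.cocycle_add x n 1
      have h2 := hF.cocycle_add h n 1
      have := (hloc n hn).1
      omega
  have hC' : N x C = N h C := by
    have := hd 0 hC
    rw [hF.cocycle_zero, hF.cocycle_zero] at this
    omega
  refine ⟨hC', fun j hj => ?_⟩
  obtain ⟨i, ⟨hi, hij⟩, hmin⟩ := Int.exists_least_of_bdd
    (P := fun i => C ≤ i ∧ j ≤ N h i) ⟨C, fun i hi => hi.1⟩ (hN j)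
  have hstep : -(V : ℤ) ≤ j - N h i := by
    rcases hi.eq_or_lt with rfl | hlt
    · omega
    · by_contra hcon
      have h1 := hF.cocycle_add h (i - 1) 1
      have h2 := abs_le.1 (hV (shiftBy X (i - 1) h))
      rw [sub_add_cancel] at h1
      have := hmin (i - 1) ⟨by omega, by omega⟩
      omega
  have hNi : N x i = N h i := by have := hd i hi; omega
  have := (hloc i hi).2 (j - N h i) (abs_le.2 ⟨hstep, by omega⟩)
  rw [← hF.apply_cocycle_add, ← hF.apply_cocycle_add, hNi] at this
  simpa using this

variable [Finite A] [DiscreteTopology A] [DiscreteTopology B] [Zero B]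

/-- Far to the left `h` looks like `p` at multiples of `P`, so each period moves the image by
exactly one zero symbol. No position is skipped, so the whole left tail of `F h` vanishes. -/
lemma tail_left (hF : IsOrbitMap X Y F N) {P : ℤ} (hP : 0 < P) {p h : X.carrier}
    (hp : shiftBy X P p = p) (hFp : ∀ j, (F p).1 j = 0) (hNp : N p P = 1) {a : ℤ}
    (hh : ∀ i ≤ a, h.1 i = p.1 i) :
    ∃ β k₀ : ℤ, ∀ k, k₀ ≤ k → N h (-(k * P)) = β - k ∧ (F h).1 (β - k) = 0 := by
  obtain ⟨W, hW⟩ := hF.exists_window_period P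
  obtain ⟨k₀, hk₀⟩ : ∃ k₀ : ℤ, ∀ k, k₀ ≤ k → -(k * P) + W ≤ a :=
    ⟨|W - a|, fun k hk => by
      have := le_abs_self (W - a)
      have := abs_nonneg (W - a)
      nlinarith⟩
  have hloc : ∀ k, k₀ ≤ k → N (shiftBy X (-(k * P)) h) P = 1 ∧
      (F (shiftBy X (-(k * P)) h)).1 0 = 0 := by
    intro k hk
    have := hW (shiftBy X (-(k * P)) h) p fun i _ h2 => by
      rw [shiftBy_apply, hh _ (by have := hk₀ k hk; omega), ← shiftBy_apply, ← neg_mul,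
        shiftBy_mul_of_periodic hp]
    rwa [hNp, hFp] at this
  have hN : ∀ k, k₀ ≤ k → N h (-(k * P)) = N h (-(k₀ * P)) + k₀ - k := by
    intro k hk
    induction k, hk using Int.leInduction with
    | base => ring
    | succ n hn ih =>
      have h1 := hF.cocycle_add h (-((n + 1) * P)) P
      rw [(hloc (n + 1) (by omega)).1, show -((n + 1) * P) + P = -(n * P) by ring, ih] at h1
      omega
  refine ⟨N h (-(k₀ * P)) + k₀, k₀, fun k hk => ⟨hN k hk, ?_⟩⟩
  have := (hloc k hk).2
  rwa [← hF.apply_cocycle_add, hN k hk, add_zero] at this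

lemma tail_right (hF : IsOrbitMap X Y F N) {P : ℤ} (hP : 0 < P) {p h : X.carrier}
    (hp : shiftBy X P p = p) (hFp : ∀ j, (F p).1 j = 0) (hNp : N p P = 1) {b e : ℤ}
    (hh : ∀ i, b ≤ i → h.1 i = p.1 (i - e)) :
    ∃ α k₀ : ℤ, ∀ k, k₀ ≤ k → N h (e + k * P) = α + k ∧ (F h).1 (α + k) = 0 := by
  obtain ⟨W, hW⟩ := hF.exists_window_period P
  obtain ⟨k₀, hk₀⟩ : ∃ k₀ : ℤ, ∀ k, k₀ ≤ k → b ≤ e + k * P - W :=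
    ⟨|W + b - e|, fun k hk => by
      have := le_abs_self (W + b - e)
      have := abs_nonneg (W + b - e)
      nlinarith⟩
  have hloc : ∀ k, k₀ ≤ k → N (shiftBy X (e + k * P) h) P = 1 ∧
      (F (shiftBy X (e + k * P) h)).1 0 = 0 := by
    intro k hk
    have := hW (shiftBy X (e + k * P) h) p fun i _ h2 => by
      rw [shiftBy_apply, hh _ (by have := hk₀ k hk; omega),
        show e + k * P + i - e = k * P + i by ring, ← shiftBy_apply,
        shiftBy_mul_of_periodic hp]
    rwa [hNp, hFp] at this
  have hN : ∀ k, k₀ ≤ k → N h (e + k * P) = N h (e + k₀ * P) - k₀ + k := by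
    intro k hk
    induction k, hk using Int.leInduction with
    | base => ring
    | succ n hn ih =>
      have h1 := hF.cocycle_add h (e + n * P) P
      rw [(hloc n hn).1, show e + n * P + P = e + (n + 1) * P by ring, ih] at h1
      omega
  refine ⟨N h (e + k₀ * P) - k₀, k₀, fun k hk => ⟨hN k hk, ?_⟩⟩
  have := (hloc k hk).2
  rwa [← hF.apply_cocycle_add, hN k hk, add_zero] at this

/-- Suppose `F` sends the periodic point `p` to the zero sequence, and `h` is homoclinic to the
orbit of `p`. If `X` contains points following `h` twice, with `k` periods of `p` in between,
then `Y` contains points with nonzero symbols at distance `k + c` and only zeros in between. -/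
lemma exists_gap (hF : IsOrbitMap X Y F N) {P : ℤ} (hP : 0 < P) {p h : X.carrier}
    (hp : shiftBy X P p = p) (hFp : ∀ j, (F p).1 j = 0) (hNp : N p P = 1) {a b e D : ℤ}
    (hleft : ∀ i ≤ a, h.1 i = p.1 i) (hright : ∀ i, b ≤ i → h.1 i = p.1 (i - e))
    (hFh : ∃ j, (F h).1 j ≠ 0) {K : Set ℤ}
    (hz : ∀ k ∈ K, ∃ z : X.carrier, (∀ i ≤ k * P, z.1 i = h.1 i) ∧
      ∀ i, D ≤ i → z.1 i = h.1 (i - k * P - e)) :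
    ∃ c k₀ : ℤ, ∀ k ∈ K, k₀ ≤ k → 0 < k + c ∧ ∃ (y : Y.carrier) (i : ℤ), y.1 i ≠ 0 ∧
      (∀ j, i < j → j < i + (k + c) → y.1 j = 0) ∧ y.1 (i + (k + c)) ≠ 0 := by
  obtain ⟨β, kl, hl⟩ := hF.tail_left hP hp hFp hNp hleft
  obtain ⟨α, kr, hr⟩ := hF.tail_right hP hp hFp hNp hright
  obtain ⟨V, W, hV, hW⟩ := hF.exists_bound_window
  have hl0 : ∀ j, j ≤ β - kl → (F h).1 j = 0 := fun j hj => by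
    simpa using (hl (β - j) (by omega)).2
  have hr0 : ∀ j, α + kr ≤ j → (F h).1 j = 0 := fun j hj => by
    simpa using (hr (j - α) (by omega)).2
  -- `f₀` and `f₁` are the positions of the first and last nonzero symbols of `F h`.
  obtain ⟨f₀, hf₀, hf₀'⟩ := Int.exists_least_of_bdd (P := fun j => (F h).1 j ≠ 0)
    ⟨β - kl, fun j hj => by by_contra hcon; exact hj (hl0 j (by omega))⟩ hFh
  obtain ⟨f₁, hf₁, hf₁'⟩ := Int.exists_greatest_of_bdd (P := fun j => (F h).1 j ≠ 0)
    ⟨α + kr, fun j hj => by by_contra hcon; exact hj (hr0 j (by omega))⟩ hFh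
  -- The cut `C = e + c₀ * P` lies in the right tail of the first copy of `h`: its image `α + c₀` is
  -- not before `f₁`, and the window around `C` starts after `D`.
  obtain ⟨c₀, hc₀, hc₁, hc₂⟩ : ∃ c₀ : ℤ, kr ≤ c₀ ∧ f₁ ≤ α + c₀ ∧ |D| + W ≤ e + c₀ * P := by
    refine ⟨|kr| + |f₁ - α| + (|D| + W + |e|), ?_, ?_, ?_⟩
    · linarith [le_abs_self kr, abs_nonneg (f₁ - α), abs_nonneg D, abs_nonneg e]
    · linarith [le_abs_self (f₁ - α), abs_nonneg kr, abs_nonneg D, abs_nonneg e]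
    · nlinarith [abs_nonneg kr, abs_nonneg (f₁ - α), abs_nonneg D, abs_nonneg e, neg_abs_le e]
  obtain ⟨C, hC⟩ : ∃ C, C = e + c₀ * P := ⟨_, rfl⟩
  rw [← hC] at hc₂
  have hDC := le_abs_self D
  have hD0 := abs_nonneg D
  have hNC : N h C = α + c₀ := by rw [hC]; exact (hr c₀ hc₀).1
  have hNl : ∀ j, ∃ i ≤ C, N h i ≤ j := by
    intro j
    have h1 : max (max kl 0) (β - j) * P ≥ 0 := by positivity
    have := (hl (max (max kl 0) (β - j)) (by omega)).1
    exact ⟨-(max (max kl 0) (β - j) * P), by omega, by omega⟩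
  -- The bounds on `k` ensure that the window at `C` ends before `k * P`, that the second copy of
  -- `h` meets `C` in its left tail, that `f₀` lies right of the cut in the second copy, and that `k
  -- + c` is positive.
  refine ⟨α - β + f₀ - f₁, max (max (C + W) (max (c₀ + kl) c₀))
    (max (β + c₀ - f₀) (β - α + f₁ - f₀ + 1)), fun k hkK hk => ⟨by omega, ?_⟩⟩
  obtain ⟨z, hz1, hz2⟩ := hz k hkK
  have hkP : k ≤ k * P := le_mul_of_one_le_right (by omega) hP
  have hE0 : 0 ≤ (k - c₀) * P := mul_nonneg (by omega) hP.le
  have hNE := (hl (k - c₀) (by omega)).1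
  have hNr : ∀ j, ∃ i, -((k - c₀) * P) ≤ i ∧ j ≤ N h i := by
    intro j
    have h1 : max (max kr c₀) (j - α) * P ≥ c₀ * P := mul_le_mul_of_nonneg_right (by omega) hP.le
    have := (hr (max (max kr c₀) (j - α)) (by omega)).1
    exact ⟨e + max (max kr c₀) (j - α) * P, by omega, by omega⟩
  obtain ⟨hzC, hzl⟩ := hF.eq_of_agree_left hV hW (x := z) (h := h) (C := C) (by omega)
    (fun i hi => hz1 i (by omega)) hNl
  have hshift : (k * P + e) + -((k - c₀) * P) = C := by rw [hC]; ring
  obtain ⟨hzE, hzr⟩ := hF.eq_of_agree_right hV hW (x := shiftBy X (k * P + e) z) (h := h)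
    (C := -((k - c₀) * P)) (by omega) (fun i hi => by
      rw [shiftBy_apply, hz2 _ (by omega)]; exact congrArg h.1 (by ring)) hNr
  -- Comparing the cocycle at the cut as seen from both copies shows that the second copy of `F h`
  -- is displaced by `k + α - β`.
  have hT := hF.cocycle_add z (k * P + e) (-((k - c₀) * P))
  rw [hshift, hzC, hzE, hNC, hNE] at hT
  have hzr' : ∀ j, β - (k - c₀) ≤ j → (F z).1 (k + α - β + j) = (F h).1 j := by
    intro j hj
    rw [← hzr j (by omega), ← hF.apply_cocycle_add]
    exact congrArg (F z).1 (by omega)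
  refine ⟨F z, f₁, by rwa [hzl f₁ (by omega)], fun j hj1 hj2 => ?_, ?_⟩
  · by_cases hj : j ≤ α + c₀
    · rw [hzl j (by omega)]
      by_contra hcon
      have := hf₁' j hcon
      omega
    · have := hzr' (j - (k + α - β)) (by omega)
      rw [show k + α - β + (j - (k + α - β)) = j by ring] at this
      rw [this]
      by_contra hcon
      have := hf₀' _ hcon
      omega
  · rw [show f₁ + (k + (α - β + f₀ - f₁)) = k + α - β + f₀ by ring, hzr' f₀ (by omega)]
    exact hf₀

end IsOrbitMap

end Transfer

/-! ### Points of gap shifts and the two uses of gap transfer -/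

section Gap

lemma occursInAt_wordPattern {A : Type*} [Inhabited A] (w : List A) (x : ℤ → A) (g : ℤ) :
    (wordPattern w).occursInAt x g ↔ ∀ n (hn : n < w.length), x (g + n) = w[n] := by
  simp only [Pattern.occursInAt, wordPattern, Finset.mem_Ico]
  constructor
  · intro h n hn
    have := h n ⟨by omega, by exact_mod_cast hn⟩
    rw [this]
    simp [hn]
  · rintro h i ⟨h0, h1⟩
    obtain ⟨n, rfl⟩ := Int.eq_ofNat_of_zero_le h0
    have hn : n < w.length := by exact_mod_cast h1
    rw [h n hn]
    simp [hn]

lemma occursInAt_gap (k : ℕ) (x : ℤ → Fin 2) (g : ℤ) :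
    (wordPattern (1 :: (List.replicate k 0 ++ [1]))).occursInAt x g ↔
      x g = 1 ∧ (∀ j, g < j → j ≤ g + k → x j = 0) ∧ x (g + k + 1) = 1 := by
  rw [occursInAt_wordPattern]
  constructor
  · intro h
    refine ⟨by simpa using h 0 (by simp), fun j h1 h2 => ?_, ?_⟩
    · have := h (j - g).toNat (by simp; omega)
      rw [show g + ((j - g).toNat : ℤ) = j by omega] at this
      rw [this]
      obtain ⟨m, hm⟩ : ∃ m, (j - g).toNat = m + 1 := ⟨(j - g).toNat - 1, by omega⟩
      simp only [hm, List.getElem_cons_succ]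
      rw [List.getElem_append_left (by simp; omega)]
      simp
    · have := h (k + 1) (by simp)
      rw [show g + ((k + 1 : ℕ) : ℤ) = g + k + 1 by push_cast; ring] at this
      rw [this]
      simp
  · rintro ⟨h0, h1, h2⟩ n hn
    rcases n with _ | m
    · simpa using h0
    · simp only [List.getElem_cons_succ]
      simp only [List.length_cons, List.length_append, List.length_replicate,
        List.length_nil] at hn
      rcases (show m < k ∨ m = k by omega) with hm | rfl
      · rw [List.getElem_append_left (by simpa using hm)]
        simpa using h1 (g + ((m + 1 : ℕ) : ℤ)) (by push_cast; omega) (by push_cast; omega)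
      · rw [show g + ((m + 1 : ℕ) : ℤ) = g + m + 1 by push_cast; ring, h2]
        simp

variable {S : Set ℕ} (hS : S.Infinite)
include hS

lemma mem_gapShift_iff (x : ℤ → Fin 2) : x ∈ (gapShift S).carrier ↔
    ∀ (i : ℤ) (k : ℕ), x i = 1 → (∀ j, i < j → j ≤ i + k → x j = 0) → x (i + k + 1) = 1 →
      k ∈ S := by
  constructor
  · intro h i k h0 h1 h2
    by_contra hk
    exact h _ ⟨_, Or.inl ⟨k, hk, rfl⟩, rfl⟩ i ((occursInAt_gap k x i).2 ⟨h0, h1, h2⟩)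
  · rintro h _ ⟨w, ⟨k, hk, rfl⟩ | ⟨m, hm, rfl⟩, rfl⟩ g hg
    · obtain ⟨h0, h1, h2⟩ := (occursInAt_gap k x g).1 hg
      exact hk (h g k h0 h1 h2)
    · obtain ⟨s, hs, hms⟩ := hS.exists_gt m
      have := hm s hs
      omega

lemma zero_mem_gapShift : (fun _ => 0 : ℤ → Fin 2) ∈ (gapShift S).carrier := by
  rw [mem_gapShift_iff hS]
  intro i k h
  simp at h

lemma splice_mem_gapShift {u v : ℤ → Fin 2} (hu : u ∈ (gapShift S).carrier)
    (hv : v ∈ (gapShift S).carrier) {m : ℤ} (hum : u m = 1) (hvm : v m = 1) :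
    (fun i => if i ≤ m then u i else v i) ∈ (gapShift S).carrier := by
  rw [mem_gapShift_iff hS] at hu hv ⊢
  intro i k h0 h1 h2
  by_cases hik : i + k + 1 ≤ m
  · refine hu i k ?_ (fun j hj1 hj2 => ?_) ?_
    · simpa [show i ≤ m by omega] using h0
    · simpa [show j ≤ m by omega] using h1 j hj1 hj2
    · simpa [hik] using h2
  · by_cases him : i < m
    · have := h1 m him (by omega)
      simp [hum] at this
    · refine hv i k ?_ (fun j hj1 hj2 => ?_) ?_
      · rcases (not_lt.1 him).eq_or_lt with h | h
        · rw [← h]; exact hvm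
        · simpa [show ¬ i ≤ m by omega] using h0
      · simpa [show ¬ j ≤ m by omega] using h1 j hj1 hj2
      · simpa [hik] using h2

lemma single_mem_gapShift : (fun i => if i = 0 then 1 else 0 : ℤ → Fin 2) ∈
    (gapShift S).carrier := by
  rw [mem_gapShift_iff hS]
  intro i k h0 h1 h2
  simp only [ite_eq_left_iff, zero_ne_one, imp_false, not_not] at h0 h2
  omega

lemma pair_mem_gapShift {s : ℕ} (hs : s ∈ S) :
    (fun i => if i = 0 ∨ i = s + 1 then 1 else 0 : ℤ → Fin 2) ∈ (gapShift S).carrier := by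
  rw [mem_gapShift_iff hS]
  intro i k h0 h1 h2
  simp only [ite_eq_left_iff, zero_ne_one, imp_false, not_not] at h0 h2
  have h3 : i = 0 ∧ i + k + 1 = s + 1 := by omega
  have : k = s := by omega
  rwa [this]

lemma exists_mem_of_gap {y : ℤ → Fin 2} (hy : y ∈ (gapShift S).carrier) {i d : ℤ} (hd : 0 < d)
    (h0 : y i ≠ 0) (h1 : ∀ j, i < j → j < i + d → y j = 0) (h2 : y (i + d) ≠ 0) :
    ∃ s ∈ S, (s : ℤ) = d - 1 := by
  refine ⟨(d - 1).toNat, (mem_gapShift_iff hS y).1 hy i _ (by omega)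
    (fun j hj1 hj2 => h1 j hj1 (by omega)) ?_, by omega⟩
  rw [show i + ((d - 1).toNat : ℤ) + 1 = i + d by omega]
  omega

variable {R : Set ℕ} (hR : R.Infinite)
include hR

/-- This is `exists_gap` with `p = 0^∞`, `P = 1` and `h` the point with a single `1`; the points
with two `1`s at distance `s + 1` follow `h` twice. -/
lemma exists_add_mem_of_map_zero {F : (gapShift S).carrier → (gapShift R).carrier}
    {N : (gapShift S).carrier → ℤ → ℤ} (hF : IsOrbitMap (gapShift S) (gapShift R) F N)
    (h0 : F ⟨_, zero_mem_gapShift hS⟩ = ⟨_, zero_mem_gapShift hR⟩)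
    (hN : N ⟨_, zero_mem_gapShift hS⟩ 1 = 1)
    (hinj : ∀ x, F x = ⟨_, zero_mem_gapShift hR⟩ → x = ⟨_, zero_mem_gapShift hS⟩) :
    ∃ c k₀ : ℤ, ∀ s ∈ S, k₀ ≤ s → ∃ r ∈ R, (r : ℤ) = s + c := by
  obtain ⟨c, k₀, h⟩ := hF.exists_gap one_pos (p := ⟨_, zero_mem_gapShift hS⟩)
    (h := ⟨_, single_mem_gapShift hS⟩) rfl (fun j => by rw [h0]) hN (a := -1) (b := 1) (e := 1)
    (D := 1) (K := (fun s : ℕ => (s : ℤ)) '' S)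
    (fun i hi => by simp; omega) (fun i hi => by simp; omega) (by
      by_contra! hcon
      have h1 := hinj _ (Subtype.ext (funext hcon))
      have h2 := congrFun (congrArg Subtype.val h1) 0
      simp at h2) (by
      rintro _ ⟨s, hs, rfl⟩
      refine ⟨⟨_, pair_mem_gapShift hS hs⟩, fun i hi => ?_, fun i hi => ?_⟩
      · simp only [mul_one] at hi
        simp only [show ¬ i = (s : ℤ) + 1 by omega, or_false]
      · simp only [mul_one, show ¬ i = 0 by omega, false_or,
          show i = (s : ℤ) + 1 ↔ i - s - 1 = 0 by omega])
  -- Nonzero symbols at distance `d` enclose `d - 1` zeros.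
  refine ⟨c - 1, k₀, fun s hs hk => ?_⟩
  obtain ⟨hpos, y, i, hy0, hy1, hy2⟩ := h s ⟨s, hs, rfl⟩ hk
  obtain ⟨r, hr, hrs⟩ := exists_mem_of_gap hR y.2 hpos hy0 hy1 hy2
  exact ⟨r, hr, by omega⟩

/-- Words of a gap shift can be spliced at any `1`, so a detour from the periodic point `y` can be
repeated after any number `k ≥ 0` of periods. Since `G` sends `y` to `0^∞`, each large `k` yields a
gap in `S`. -/
lemma cofinite_of_periodic_map_zero {G : (gapShift R).carrier → (gapShift S).carrier}
    {M : (gapShift R).carrier → ℤ → ℤ} (hG : IsOrbitMap (gapShift R) (gapShift S) G M)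
    {y : (gapShift R).carrier} {P : ℤ} (hP : 0 < P) (hyP : shiftBy _ P y = y)
    (hGy : G y = ⟨_, zero_mem_gapShift hS⟩) (hM : M y P = 1) (hy0 : y.1 0 = 1)
    (hinj : ∀ x, G x = ⟨_, zero_mem_gapShift hS⟩ → ∃ j, x = shiftBy _ j y) :
    ∃ k₀ : ℕ, ∀ k, k₀ ≤ k → k ∈ S := by
  have hper : ∀ k i : ℤ, y.1 (k * P + i) = y.1 i := fun k i => by
    rw [← shiftBy_apply, shiftBy_mul_of_periodic hyP]
  -- The detour `h` inserts one gap of length `s` into `y`. With `s > P` this gives `h 0 = 1` and `h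
  -- P = 0`, so `h` is not `P`-periodic and lies outside the orbit of `y`.
  obtain ⟨s, hs, hsP⟩ := hR.exists_gt P.toNat
  obtain ⟨h, hhdef⟩ : ∃ h : (gapShift R).carrier, ∀ i : ℤ, h.1 i = if i ≤ 0 then y.1 i else
      if i ≤ s + 1 then (if i = 0 ∨ i = s + 1 then 1 else 0) else y.1 (-(s + 1) + i) :=
    ⟨⟨_, splice_mem_gapShift hR y.2 (splice_mem_gapShift hR (pair_mem_gapShift hR hs)
      (shiftBy _ (-(s + 1) : ℤ) y).2 (m := s + 1) (by simp)
      (by rw [shiftBy_apply, neg_add_cancel, hy0])) (m := 0) hy0 (by simp; omega)⟩, fun i => rfl⟩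
  have hh1 : ∀ k : ℤ, 0 ≤ k → h.1 (k * P + (s + 1)) = 1 := by
    intro k hk
    have hkP : 0 ≤ k * P := by positivity
    rw [hhdef, if_neg (by omega)]
    split_ifs with h1 h2
    · rfl
    · omega
    · rw [show -((s : ℤ) + 1) + (k * P + (s + 1)) = k * P + 0 by ring, hper, hy0]
  obtain ⟨c, k₀, hc⟩ := hG.exists_gap hP (p := y) (h := h) hyP (fun j => by rw [hGy]) hM
    (a := 0) (b := s + 2) (e := s + 1) (D := s + 2) (K := Set.Ici 0)
    (fun i hi => by rw [hhdef, if_pos hi])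
    (fun i hi => by
      rw [hhdef, if_neg (by omega), if_neg (by omega)]; exact congrArg y.1 (by ring)) (by
      by_contra! hcon
      obtain ⟨j, hj⟩ := hinj h (Subtype.ext (funext hcon))
      have e0 : h.1 0 = 1 := by rw [hhdef, if_pos le_rfl, hy0]
      have e1 : h.1 P = 0 := by
        rw [hhdef, if_neg (by omega), if_pos (by omega), if_neg (by omega)]
      have : h.1 P = h.1 0 := by
        rw [hj, shiftBy_apply, shiftBy_apply, show j + P = 1 * P + (j + 0) by ring, hper]
      rw [e0, e1] at this
      simp at this) (by
      intro k hk
      refine ⟨⟨_, splice_mem_gapShift hR h.2 (shiftBy _ (-(k * P + (s + 1))) h).2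
        (m := k * P + (s + 1)) (hh1 k hk) (by
          rw [shiftBy_apply, neg_add_cancel, hhdef, if_pos le_rfl, hy0])⟩,
        fun i hi => ?_, fun i hi => ?_⟩
      · simp only
        rw [if_pos (by omega)]
      · simp only
        split_ifs with h1
        · rw [hhdef, hhdef, if_neg (by omega), if_neg (by omega), if_pos (by omega),
            ← hper k (i - k * P - (s + 1))]
          exact congrArg y.1 (by ring)
        · exact congrArg h.1 (by ring))
  refine ⟨(max (k₀ + c) c).toNat, fun k hk => ?_⟩
  obtain ⟨hpos, x, i, hx0, hx1, hx2⟩ := hc (k + 1 - c)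
    (show (0 : ℤ) ≤ k + 1 - c by omega) (by omega)
  obtain ⟨r, hr, hrk⟩ := exists_mem_of_gap hS x.2 hpos hx0 hx1 hx2
  have : r = k := by omega
  rwa [← this]

end Gap

/-! ### Eventual invariance of sets of integers under translation -/

section Numeric

/-- Beyond `n₀`, in each residue class modulo `δ`, `p` can turn from false to true only once, so the
equivalence fails finitely often. -/
lemma eventually_iff_add_of_eventually_imp {p : ℤ → Prop} {δ n₀ : ℤ} (hδ : 0 < δ)
    (h : ∀ n, n₀ ≤ n → p n → p (n + δ)) : ∃ n₁, ∀ n, n₁ ≤ n → (p n ↔ p (n + δ)) := by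
  have hiter : ∀ n, n₀ ≤ n → p n → ∀ k : ℕ, p (n + k * δ) := by
    intro n hn hp k
    induction k with
    | zero => simpa using hp
    | succ k ih =>
      have hk : 0 ≤ (k : ℤ) * δ := by positivity
      have := h _ (by omega) ih
      rwa [show n + ((k + 1 : ℕ) : ℤ) * δ = n + k * δ + δ by push_cast; ring]
  have hlt : ∀ m n, m ∈ {n | n₀ ≤ n ∧ ¬ p n ∧ p (n + δ)} →
      n ∈ {n | n₀ ≤ n ∧ ¬ p n ∧ p (n + δ)} → m % δ = n % δ → ¬ m < n := by
    rintro m n ⟨hm0, -, hmp⟩ ⟨-, hn, -⟩ hmn hlt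
    obtain ⟨q, hq⟩ : δ ∣ n - m := Int.ModEq.dvd hmn
    have hq0 : 0 < q := by
      by_contra hcon
      have : δ * q ≤ 0 := mul_nonpos_of_nonneg_of_nonpos hδ.le (by omega)
      omega
    apply hn
    have := hiter (m + δ) (by omega) hmp (q - 1).toNat
    rw [show (((q - 1).toNat : ℕ) : ℤ) = q - 1 by omega] at this
    rwa [show n = m + δ + (q - 1) * δ by linarith]
  have hfin : {n | n₀ ≤ n ∧ ¬ p n ∧ p (n + δ)}.Finite := by
    refine Set.Finite.of_finite_image (f := fun n => n % δ)
      ((Set.finite_Ico 0 δ).subset ?_) ?_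
    · rintro _ ⟨n, -, rfl⟩
      exact ⟨Int.emod_nonneg _ hδ.ne', Int.emod_lt_of_pos _ hδ⟩
    · intro m hm n hn hmn
      have h1 := hlt m n hm hn hmn
      have h2 := hlt n m hn hm hmn.symm
      omega
  obtain ⟨M, hM⟩ := hfin.bddAbove
  refine ⟨max n₀ (M + 1), fun n hn => ⟨h n (by omega), fun hp => ?_⟩⟩
  by_contra hcon
  have := hM ⟨by omega, hcon, hp⟩
  omega

/-- Going to `q` and back translates `p` by `c + c'`, so `p` is eventually invariant under this
translation; for a negative one, the previous argument applies to `¬ p`. Then `q (n + c)` implies `p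
(n + c + c')`, hence `p n`. -/
lemma exists_eventually_iff_add {p q : ℤ → Prop} {c c' n₀ : ℤ}
    (hp : ∀ n, n₀ ≤ n → p n → q (n + c)) (hq : ∀ n, n₀ ≤ n → q n → p (n + c')) :
    ∃ n₁, ∀ n, n₁ ≤ n → (p n ↔ q (n + c)) := by
  have hpp : ∀ n, max n₀ (n₀ - c) ≤ n → p n → p (n + (c + c')) := fun n hn h => by
    rw [← add_assoc]; exact hq _ (by omega) (hp n (by omega) h)
  obtain ⟨n₁, hn₁⟩ : ∃ n₁, ∀ n, n₁ ≤ n → (p n ↔ p (n + (c + c'))) := by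
    rcases lt_trichotomy (c + c') 0 with hd | hd | hd
    · obtain ⟨n₁, hn₁⟩ := eventually_iff_add_of_eventually_imp (p := fun n => ¬ p n)
        (δ := -(c + c')) (n₀ := max n₀ (n₀ - c)) (by omega) fun n hn h1 h2 => h1 (by
          have := hpp _ (by omega) h2
          rwa [neg_add_cancel_right] at this)
      refine ⟨n₁ - (c + c'), fun n hn => ?_⟩
      have := hn₁ (n + (c + c')) (by omega)
      rw [add_neg_cancel_right, not_iff_not] at this
      exact this.symm
    · exact ⟨0, fun n _ => by rw [hd, add_zero]⟩
    · exact eventually_iff_add_of_eventually_imp hd hpp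
  refine ⟨max (max n₀ (n₀ - c)) n₁, fun n hn => ⟨hp n (by omega), fun h => ?_⟩⟩
  rw [hn₁ n (by omega), ← add_assoc]
  exact hq _ (by omega) h

lemma exists_translate_of_eventually {S R : Set ℕ} {r n₁ : ℤ}
    (h : ∀ n, n₁ ≤ n → ((∃ s ∈ S, (s : ℤ) = n) ↔ ∃ t ∈ R, (t : ℤ) = n + r)) :
    ∃ S' R' : Set ℕ, S' ⊆ S ∧ (S \ S').Finite ∧ R' ⊆ R ∧ (R \ R').Finite ∧
      ∃ r : ℤ, (fun s : ℕ => (s : ℤ) + r) '' S' = (fun s : ℕ => (s : ℤ)) '' R' := by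
  refine ⟨{s ∈ S | n₁ ≤ s}, {t ∈ R | n₁ + r ≤ t}, fun s hs => hs.1, ?_, fun s hs => hs.1, ?_,
    r, ?_⟩
  · refine (Set.finite_Iio n₁.toNat).subset fun s hs => ?_
    have : ¬ n₁ ≤ s := fun h => hs.2 ⟨hs.1, h⟩
    simp only [mem_Iio]; omega
  · refine (Set.finite_Iio (n₁ + r).toNat).subset fun s hs => ?_
    have : ¬ n₁ + r ≤ s := fun h => hs.2 ⟨hs.1, h⟩
    simp only [mem_Iio]; omega
  · ext n
    constructor
    · rintro ⟨s, ⟨hs, hsn⟩, rfl⟩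
      obtain ⟨t, ht, hts⟩ := (h s hsn).1 ⟨s, hs, rfl⟩
      exact ⟨t, ⟨ht, by omega⟩, hts⟩
    · rintro ⟨t, ⟨ht, htn⟩, rfl⟩
      obtain ⟨s, hs, hst⟩ := (h (t - r) (by omega)).2 ⟨t, ht, by omega⟩
      exact ⟨s, ⟨hs, by omega⟩, by simp only; omega⟩

end Numeric

/-! ### Monotonicity of a continuous function modulo integers -/

section Monotone

/-- `φ` may jump, but just to the right of any `c` both `f` and `φ` vary by less than `1/2`, so
their integer difference is constant there and `f` increases. Continuous induction along `[a, b]`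
concludes. -/
lemma monotone_of_sub_int {f φ : ℝ → ℝ} (hf : Continuous f) (hφ : Monotone φ)
    (h : ∀ r, ∃ k : ℤ, f r = φ r + k) : Monotone f := by
  intro a b hab
  have hclosed : IsClosed ({r | f a ≤ f r} ∩ Icc a b) :=
    (isClosed_le continuous_const hf).inter isClosed_Icc
  refine hclosed.Icc_subset_of_forall_mem_nhdsWithin (le_refl (f a)) (fun c hc => ?_)
    (right_mem_Icc.2 hab)
  have h1 : ∀ᶠ r in 𝓝[>] c, |φ r - Function.rightLim φ c| < 1 / 4 := by
    have := (hφ.tendsto_rightLim c).eventually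
      (Metric.ball_mem_nhds _ (by norm_num : (0 : ℝ) < 1 / 4))
    simpa [Real.dist_eq] using this
  have h2 : ∀ᶠ r in 𝓝[>] c, |f r - f c| < 1 / 4 := by
    have := (hf.continuousAt (x := c)).mono_left (nhdsWithin_le_nhds (s := Ioi c)) |>.eventually
      (Metric.ball_mem_nhds _ (by norm_num : (0 : ℝ) < 1 / 4))
    simpa [Real.dist_eq] using this
  obtain ⟨u, hu, hcu⟩ := mem_nhdsGT_iff_exists_Ioo_subset.1 (h1.and h2)
  have hmono : ∀ r ∈ Ioo c u, ∀ s ∈ Ioo c u, s ≤ r → f s ≤ f r := by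
    intro r hr s hs hsr
    obtain ⟨k, hk⟩ := h r
    obtain ⟨l, hl⟩ := h s
    obtain ⟨hr1, hr2⟩ := hcu hr
    obtain ⟨hs1, hs2⟩ := hcu hs
    rw [abs_lt] at hr1 hr2 hs1 hs2
    have hkl : k = l := by
      have a1 : ((k - l : ℤ) : ℝ) < ((1 : ℤ) : ℝ) := by push_cast; linarith
      have a2 : ((-1 : ℤ) : ℝ) < ((k - l : ℤ) : ℝ) := by push_cast; linarith
      have := Int.cast_lt.1 a1
      have := Int.cast_lt.1 a2
      omega
    rw [hk, hl, hkl]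
    have := hφ hsr
    linarith
  refine mem_nhdsGT_iff_exists_Ioo_subset.2 ⟨u, hu, fun r hr => ?_⟩
  have hlim : Filter.Tendsto f (𝓝[>] c) (𝓝 (f c)) :=
    (hf.continuousAt (x := c)).mono_left nhdsWithin_le_nhds
  have hfc : f c ≤ f r := by
    refine le_of_tendsto hlim ?_
    filter_upwards [Ioo_mem_nhdsGT hr.1] with s hs
    exact hmono r hr s ⟨hs.1, hs.2.trans hr.2⟩ hs.2.le
  exact le_trans hc.1 hfc

end Monotone

/-! ### Lifts of a flow equivalence and of its inverse -/

section Flow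

variable {A B : Type*} [TopologicalSpace A] [TopologicalSpace B]
  {X : Subshift A ℤ} {Y : Subshift B ℤ} {F : X.carrier → Y.carrier} {N : X.carrier → ℤ → ℤ}
  {L : X.carrier × ℝ → ℝ}

lemma monotone_lift {Φ : Suspension X ≃ₜ Suspension Y} (hΦ : IsFlowEquivalence X Y Φ)
    (hL : Continuous L) (h : ∀ x r, Φ (Suspension.mk X x r) = Suspension.mk Y (F x) (L (x, r)))
    (x : X.carrier) : Monotone fun r => L (x, r) := by
  obtain ⟨φ, hφ, hφx⟩ := hΦ x 0
  refine monotone_of_sub_int (φ := fun r => L (x, 0) + φ r) (by fun_prop)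
    (fun a b hab => by simpa using hφ hab) fun r => ?_
  have h1 := hφx _ _ (h x 0) r
  rw [zero_add, h] at h1
  obtain ⟨k, hk, -⟩ := (mk_eq_mk_iff Y).1 h1
  exact ⟨k, hk⟩

/-- The integer relating a point to its round trip is continuous in `r`, hence constant. -/
lemma exists_shiftBy_of_comp_eq_id {Φ : Suspension X → Suspension Y}
    {Ψ : Suspension Y → Suspension X}
    (hΨΦ : ∀ p, Ψ (Φ p) = p) {G : Y.carrier → X.carrier} {K : Y.carrier × ℝ → ℝ}
    (hL : Continuous L) (hK : Continuous K)
    (h : ∀ x r, Φ (Suspension.mk X x r) = Suspension.mk Y (F x) (L (x, r)))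
    (h' : ∀ y r, Ψ (Suspension.mk Y y r) = Suspension.mk X (G y) (K (y, r))) (x : X.carrier) :
    ∃ j : ℤ, G (F x) = shiftBy X j x ∧ ∀ r, K (F x, L (x, r)) = r - j := by
  have key : ∀ r, ∃ j : ℤ, r = K (F x, L (x, r)) + j ∧ G (F x) = shiftBy X j x := fun r => by
    apply (mk_eq_mk_iff X).1
    rw [← h', ← h, hΨΦ]
  choose j hj1 hj2 using key
  have hjc : Continuous j := by
    apply continuous_of_continuous_intCast
    have : (fun r => (j r : ℝ)) = fun r => r - K (F x, L (x, r)) := by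
      funext r; have := hj1 r; linarith
    rw [this]; fun_prop
  have hconst : ∀ r, j r = j 0 := fun r =>
    (isPreconnected_range hjc).subsingleton ⟨r, rfl⟩ ⟨0, rfl⟩
  refine ⟨j 0, hj2 0, fun r => ?_⟩
  have := hj1 r
  rw [hconst r] at this
  linarith

lemma exists_eq_shiftBy_of_map_eq {G : Y.carrier → X.carrier}
    (hGF : ∀ x, ∃ j : ℤ, G (F x) = shiftBy X j x) {x x' : X.carrier} (h : F x = F x') :
    ∃ j, x = shiftBy X j x' := by
  obtain ⟨j, hj⟩ := hGF x
  obtain ⟨j', hj'⟩ := hGF x'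
  refine ⟨-j + j', ?_⟩
  rw [← shiftBy_shiftBy, ← hj', ← h, hj]
  simp

lemma IsOrbitMap.cocycle_of_fixed (hF : IsOrbitMap X Y F N) {x : X.carrier}
    (hx : ∀ k, shiftBy X k x = x) (k : ℤ) : N x k = k * N x 1 := by
  induction k using Int.induction_on with
  | zero => simp [hF.cocycle_zero]
  | succ n ih => rw [hF.cocycle_add, hx, ih]; ring
  | pred n ih =>
    have := hF.cocycle_add x (-n - 1) 1
    rw [sub_add_cancel, ih, hx] at this
    linarith

lemma IsOrbitMap.cocycle_shiftBy_of_periodic (hF : IsOrbitMap X Y F N) {x : X.carrier} {P : ℤ}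
    (hx : shiftBy X P x = x) (j : ℤ) : N (shiftBy X j x) P = N x P := by
  have h1 := hF.cocycle_add x j P
  have h2 := hF.cocycle_add x P j
  rw [hx, add_comm P j] at h2
  omega

/-- The image of a fixed point is periodic, and the inverse orbit map winds once around the fixed
point along this period. -/
lemma cocycle_image_fixed {K : Y.carrier × ℝ → ℝ}
    {M : Y.carrier → ℤ → ℤ} (hF : IsOrbitMap X Y F N)
    (hLN : ∀ x (k : ℤ) (r : ℝ), L (x, r + k) = L (shiftBy X k x, r) + N x k)
    (hKM : ∀ y (k : ℤ) (r : ℝ), K (y, r + k) = K (shiftBy Y k y, r) + M y k)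
    {x : X.carrier} (hx : ∀ k, shiftBy X k x = x)
    (hKL : ∃ j : ℤ, ∀ r, K (F x, L (x, r)) = r - j) :
    shiftBy Y (N x 1) (F x) = F x ∧ M (F x) (N x 1) = 1 := by
  have hper : shiftBy Y (N x 1) (F x) = F x := by rw [← hF.map_shiftBy, hx]
  refine ⟨hper, ?_⟩
  obtain ⟨j, hj⟩ := hKL
  have h1 := hKM (F x) (N x 1) (L (x, 0))
  have h2 := hLN x 1 0
  rw [hx] at h2
  push_cast at h2
  rw [← h2, hper, hj, hj] at h1
  have : ((M (F x) (N x 1) : ℤ) : ℝ) = ((1 : ℤ) : ℝ) := by push_cast; linarith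
  exact_mod_cast this

end Flow

/-! ### The fixed point `0^∞` and the case distinction -/

section Main

variable {S R : Set ℕ} (hS : S.Infinite) (hR : R.Infinite)

/-- The fixed point `0^∞` of the gap shift of an infinite set. -/
noncomputable def zeroPoint {S : Set ℕ} (hS : S.Infinite) : (gapShift S).carrier :=
  ⟨_, zero_mem_gapShift hS⟩

lemma shiftBy_zeroPoint (k : ℤ) : shiftBy _ k (zeroPoint hS) = zeroPoint hS := rfl

include hS hR

lemma cofinite_of_map_zero_ne {F : (gapShift S).carrier → (gapShift R).carrier}
    {G : (gapShift R).carrier → (gapShift S).carrier} {M : (gapShift R).carrier → ℤ → ℤ}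
    (hG : IsOrbitMap (gapShift R) (gapShift S) G M)
    (hGF : ∀ x, ∃ j : ℤ, G (F x) = shiftBy _ j x) (hFG : ∀ y, ∃ j : ℤ, F (G y) = shiftBy _ j y)
    {P : ℤ} (hP : 0 < P) (hyP : shiftBy _ P (F (zeroPoint hS)) = F (zeroPoint hS))
    (hM : M (F (zeroPoint hS)) P = 1) (hne : F (zeroPoint hS) ≠ zeroPoint hR) :
    ∃ k₀ : ℕ, ∀ k, k₀ ≤ k → k ∈ S := by
  obtain ⟨i, hi⟩ : ∃ i, (F (zeroPoint hS)).1 i ≠ 0 := by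
    by_contra! hcon
    exact hne (Subtype.ext (funext hcon))
  obtain ⟨j, hj⟩ := hGF (zeroPoint hS)
  -- Recentre the periodic image at a nonzero symbol; `G` still sends it to `0^∞`, which is fixed by
  -- the shift.
  have hGy : G (shiftBy _ i (F (zeroPoint hS))) = zeroPoint hS := by
    rw [hG.map_shiftBy, hj, shiftBy_zeroPoint, shiftBy_zeroPoint]
  refine cofinite_of_periodic_map_zero hS hR hG (y := shiftBy _ i (F (zeroPoint hS))) hP ?_ hGy
    ?_ ?_ fun x hx => exists_eq_shiftBy_of_map_eq hFG (hx.trans hGy.symm)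
  · rw [shiftBy_shiftBy, add_comm, ← shiftBy_shiftBy, hyP]
  · rw [hG.cocycle_shiftBy_of_periodic hyP, hM]
  · rw [shiftBy_apply, add_zero]
    omega

lemma exists_add_mem {F : (gapShift S).carrier → (gapShift R).carrier}
    {G : (gapShift R).carrier → (gapShift S).carrier} {N : (gapShift S).carrier → ℤ → ℤ}
    (hF : IsOrbitMap (gapShift S) (gapShift R) F N)
    (hGF : ∀ x, ∃ j : ℤ, G (F x) = shiftBy _ j x) (h0 : F (zeroPoint hS) = zeroPoint hR)
    (hN : N (zeroPoint hS) 1 = 1) :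
    ∃ c k₀ : ℤ, ∀ s ∈ S, k₀ ≤ s → ∃ r ∈ R, (r : ℤ) = s + c :=
  exists_add_mem_of_map_zero hS hR hF h0 hN fun x hx => by
    obtain ⟨j, hj⟩ := exists_eq_shiftBy_of_map_eq hGF (hx.trans h0.symm)
    exact hj.trans (shiftBy_zeroPoint hS j)

omit hS hR in
lemma exists_translate_of_cofinite (hS' : ∃ k₀ : ℕ, ∀ k, k₀ ≤ k → k ∈ S)
    (hR' : ∃ k₀ : ℕ, ∀ k, k₀ ≤ k → k ∈ R) :
    ∃ S' R' : Set ℕ, S' ⊆ S ∧ (S \ S').Finite ∧ R' ⊆ R ∧ (R \ R').Finite ∧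
      ∃ r : ℤ, (fun s : ℕ => (s : ℤ) + r) '' S' = (fun s : ℕ => (s : ℤ)) '' R' := by
  obtain ⟨k, hk⟩ := hS'
  obtain ⟨l, hl⟩ := hR'
  refine exists_translate_of_eventually (r := 0) (n₁ := max k l) fun n hn => ?_
  exact ⟨fun _ => ⟨n.toNat, hl _ (by omega), by omega⟩,
    fun _ => ⟨n.toNat, hk _ (by omega), by omega⟩⟩

end Main

/-- Flow equivalent gap shifts come from sets that eventually agree up to a translation. -/
theorem exists_translate_of_flowEquivalent (S R : Set ℕ) (hS : S.Infinite) (hR : R.Infinite)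
    (h : FlowEquivalent (gapShift S) (gapShift R)) :
    ∃ S' R' : Set ℕ, S' ⊆ S ∧ (S \ S').Finite ∧ R' ⊆ R ∧ (R \ R').Finite ∧
      ∃ r : ℤ, (fun s : ℕ => (s : ℤ) + r) '' S' = (fun s : ℕ => (s : ℤ)) '' R' := by
  obtain ⟨Φ, hΦ⟩ := h
  obtain ⟨F, L, hFc, hLc, hFL⟩ := exists_lift_suspension _ _ Φ.continuous
  obtain ⟨G, K, hGc, hKc, hGK⟩ := exists_lift_suspension _ _ Φ.symm.continuous
  obtain ⟨N, hF, hLN⟩ := exists_isOrbitMap hFc hLc hFL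
  obtain ⟨M, hG, hKM⟩ := exists_isOrbitMap hGc hKc hGK
  have hmono := monotone_lift hΦ hLc hFL
  have hGF := exists_shiftBy_of_comp_eq_id Φ.symm_apply_apply hLc hKc hFL hGK
  have hFG := exists_shiftBy_of_comp_eq_id Φ.apply_symm_apply hKc hLc hGK hFL
  have hGF' : ∀ x, ∃ j : ℤ, G (F x) = shiftBy _ j x := fun x => (hGF x).imp fun _ h => h.1
  have hFG' : ∀ y, ∃ j : ℤ, F (G y) = shiftBy _ j y := fun y => (hFG y).imp fun _ h => h.1
  obtain ⟨hper, hM1⟩ := cocycle_image_fixed hF hLN hKM (shiftBy_zeroPoint hS)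
    ((hGF _).imp fun _ h => h.2)
  obtain ⟨hper', hN1⟩ := cocycle_image_fixed hG hKM hLN (shiftBy_zeroPoint hR)
    ((hFG _).imp fun _ h => h.2)
  -- Monotonicity of `L` gives `0 ≤ N`, and `N = 0` would contradict `hM1`, as a cocycle vanishes at
  -- `0`.
  have hn : 0 < N (zeroPoint hS) 1 := by
    have h1 := hLN (zeroPoint hS) 1 0
    rw [shiftBy_zeroPoint] at h1
    have h2 : L (zeroPoint hS, 0) ≤ L (zeroPoint hS, 0 + ((1 : ℤ) : ℝ)) :=
      hmono _ (by norm_num)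
    have h3 : (0 : ℝ) ≤ N (zeroPoint hS) 1 := by linarith
    have h4 : 0 ≤ N (zeroPoint hS) 1 := by exact_mod_cast h3
    refine h4.lt_of_ne fun h5 => ?_
    rw [← h5, hG.cocycle_zero] at hM1
    omega
  -- Along `M (zeroPoint hR) 1` steps of the periodic point `G (zeroPoint hR)`, the increasing lift
  -- `L` gains `1`.
  have hm : 0 < M (zeroPoint hR) 1 := by
    by_contra hcon
    have h1 := hLN (G (zeroPoint hR)) (M (zeroPoint hR) 1) 0
    rw [hper', hN1] at h1
    have h2 : L (G (zeroPoint hR), 0 + (M (zeroPoint hR) 1 : ℝ)) ≤ L (G (zeroPoint hR), 0) :=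
      hmono _ (by
        have : (M (zeroPoint hR) 1 : ℝ) ≤ 0 := by exact_mod_cast not_lt.1 hcon
        linarith)
    push_cast at h1
    linarith
  have hSc := cofinite_of_map_zero_ne hS hR hG hGF' hFG' hn hper hM1
  have hRc := cofinite_of_map_zero_ne hR hS hF hFG' hGF' hm hper' hN1
  by_cases hcof : (∃ k₀ : ℕ, ∀ k, k₀ ≤ k → k ∈ S) ∧ ∃ k₀ : ℕ, ∀ k, k₀ ≤ k → k ∈ R
  · exact exists_translate_of_cofinite hcof.1 hcof.2
  -- If one of the maps preserves `0^∞`, so does the other, because round trips stay in the orbit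
  -- and this orbit is a single point.
  have h0 : F (zeroPoint hS) = zeroPoint hR ∧ G (zeroPoint hR) = zeroPoint hS := by
    rcases not_and_or.1 hcof with hc | hc
    · have hF0 := not_not.1 fun hne => hc (hSc hne)
      obtain ⟨j, hj⟩ := hGF' (zeroPoint hS)
      rw [hF0, shiftBy_zeroPoint] at hj
      exact ⟨hF0, hj⟩
    · have hG0 := not_not.1 fun hne => hc (hRc hne)
      obtain ⟨j, hj⟩ := hFG' (zeroPoint hR)
      rw [hG0, shiftBy_zeroPoint] at hj
      exact ⟨hj, hG0⟩
  -- The two winding numbers along `0^∞` are positive integers with product `1`.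
  rw [h0.1, hG.cocycle_of_fixed (shiftBy_zeroPoint hR)] at hM1
  have hN : N (zeroPoint hS) 1 = 1 := Int.eq_one_of_mul_eq_one_right hn.le hM1
  have hM : M (zeroPoint hR) 1 = 1 := by rwa [hN, one_mul] at hM1
  obtain ⟨c, k₀, hc⟩ := exists_add_mem hS hR hF hGF' h0.1 hN
  obtain ⟨c', k₁, hc'⟩ := exists_add_mem hR hS hG hFG' h0.2 hM
  obtain ⟨n₁, hn₁⟩ := exists_eventually_iff_add (p := fun n => ∃ s ∈ S, (s : ℤ) = n)
    (q := fun n => ∃ t ∈ R, (t : ℤ) = n) (c := c) (c' := c') (n₀ := max k₀ k₁)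
    (fun n hn ⟨s, hs, hsn⟩ => hsn ▸ hc s hs (by omega))
    (fun n hn ⟨t, ht, htn⟩ => htn ▸ hc' t ht (by omega))
  exact exists_translate_of_eventually hn₁

end GapShift

theorem mainTheorem1 (S R : Set ℕ) (hS : S.Infinite) (hR : R.Infinite)
    (h : GapShift.FlowEquivalent (GapShift.gapShift S) (GapShift.gapShift R)) :
    ∃ S' R' : Set ℕ, S' ⊆ S ∧ (S \ S').Finite ∧ R' ⊆ R ∧ (R \ R').Finite ∧
      ∃ r : ℤ, (fun s : ℕ => (s : ℤ) + r) '' S' = (fun s : ℕ => (s : ℤ)) '' R' :=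
  GapShift.exists_translate_of_flowEquivalent S R hS hR h
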